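/- Let $p^*\in\mathbb N$, let $\Upsilon\subseteq\mathbb R^{p^*}$, $\upsilon^*\in\Upsilon$, let $\mathcal D:\mathbb R^{p^*}\to\mathbb R^{p^*}$ be linear, and for $\mathtt r\ge 0$ put $\Upsilon_\circ(\mathtt r)=\{\upsilon\in\Upsilon:\|\mathcal D(\upsilon-\upsilon^*)\|\le \mathtt r\}$, where $\|\cdot\|$ is the Euclidean norm for vectors and the spectral norm for matrices. Let $\mathtt r^*,\mathtt g,\omega_2,\nu_2>0$, and let $(\mathcal Y(\upsilon))_{\upsilon\in\Upsilon}$ be a random process with values in $\mathbb R^{p^*\times p^*}$, with almost surely continuous paths on $\Upsilon_\circ(\mathtt r^*)$ and with $\mathcal Y(\upsilon^*)=0$ almost surely. Suppose that for all $0<\mathtt r<\mathtt r^*$, all $\upsilon,\upsilon^\circ\in\Upsilon_\circ(\mathtt r)$ and all $|\lambda|\le\mathtt g$, $$\sup_{\|u_1\|\le 1}\ \sup_{\|u_2\|\le 1}\ \log \mathbb E\exp\Bigl\{\lambda\,\frac{u_1^\top\bigl(\mathcal Y(\upsilon)-\mathcal Y(\upsilon^\circ)\bigr)u_2}{\omega_2\|\mathcal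 D(\upsilon-\upsilon^\circ)\|}\Bigr\}\le\frac{\nu_2^2\lambda^2}{2},$$ where, if $\mathcal D(\upsilon-\upsilon^\circ)=0$, the condition is understood to say that $\mathcal Y(\upsilon)=\mathcal Y(\upsilon^\circ)$ almost surely. Put $\mathtt g_0=\nu_2\mathtt g$ and $$\mathfrak z(\mathtt x,\mathbb Q)=\begin{cases}\sqrt{2(\mathtt x+\mathbb Q)}&\text{if }\sqrt{2(\mathtt x+\mathbb Q)}\le \mathtt g_0,\\ \mathtt g_0^{-1}(\mathtt x+\mathbb Q)+\mathtt g_0/2&\text{otherwise.}\end{cases}$$ Then for each $0\le\mathtt r\le\mathtt r^*$ and each $\mathtt x\ge 0$, with probability at least $1-e^{-\mathtt x}$, $$\sup_{\upsilon\in\Upsilon_\circ(\mathtt r)}\|\mathcal Y(\upsilon)\|\le 9\,\omega_2\,\nu_2\,\mathfrak z(\mathtt x,6p^*)\,\mathtt r ,$$ where in the endpoint case $\mathtt r=\mathtt r^*$ it is assumed in addition that every point of $\Upsilon_\circ(\mathtt r^*)$ is a limit of points $\upsilon\in\Upsilon$ with $\|\mathcal D(\upsilon-\upsilon^*)\|<\mathtt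 r^*$ (this holds whenever $\Upsilon$ is open or star-shaped about $\upsilon^*$, in particular for $\Upsilon=\mathbb R^{p^*}$). -/

import Mathlib

open MeasureTheory ProbabilityTheory
open scoped Matrix

noncomputable section

namespace SpectralProcess

/-- The spectral norm of a real `p × p` matrix: its operator norm for the Euclidean norm. -/
def matNorm {p : ℕ} (M : Matrix (Fin p) (Fin p) ℝ) : ℝ :=
  ‖Matrix.toEuclideanCLM (n := Fin p) (𝕜 := ℝ) M‖

/-- The bilinear form `u₁ᵀ M u₂`. -/
def bilin {p : ℕ} (u₁ : EuclideanSpace ℝ (Fin p)) (M : Matrix (Fin p) (Fin p) ℝ)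
    (u₂ : EuclideanSpace ℝ (Fin p)) : ℝ :=
  u₁.ofLp ⬝ᵥ (M *ᵥ u₂.ofLp)

/-- The local set `Υ(r) = {υ ∈ Υ : ‖D (υ - υ₀)‖ ≤ r}`. -/
def localSet {p : ℕ} (Υ : Set (EuclideanSpace ℝ (Fin p)))
    (D : EuclideanSpace ℝ (Fin p) →ₗ[ℝ] EuclideanSpace ℝ (Fin p))
    (υ₀ : EuclideanSpace ℝ (Fin p)) (r : ℝ) : Set (EuclideanSpace ℝ (Fin p)) :=
  {υ | υ ∈ Υ ∧ ‖D (υ - υ₀)‖ ≤ r}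

/-- The quantile function `𝔷(x, Q)`, which also depends on `g₀`. -/
def zfun (g₀ x Q : ℝ) : ℝ :=
  if √(2 * (x + Q)) ≤ g₀ then √(2 * (x + Q)) else g₀⁻¹ * (x + Q) + g₀ / 2

/-- The normalized bilinear increment `u₁ᵀ (Y(υ) - Y(υ')) u₂ / (ω₂ ‖D (υ - υ')‖)`. -/
def normIncr {p : ℕ} {Ω : Type*}
    (Y : EuclideanSpace ℝ (Fin p) → Ω → Matrix (Fin p) (Fin p) ℝ)
    (D : EuclideanSpace ℝ (Fin p) →ₗ[ℝ] EuclideanSpace ℝ (Fin p)) (ω₂ : ℝ)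
    (υ υ' u₁ u₂ : EuclideanSpace ℝ (Fin p)) (ω : Ω) : ℝ :=
  bilin u₁ (Y υ ω - Y υ' ω) u₂ / (ω₂ * ‖D (υ - υ')‖)

/-- The exponential moment condition: for `0 < r < r*`, `υ, υ' ∈ Υ(r)`, `|t| ≤ g` and `u₁, u₂` in
the unit ball, `log E exp (t u₁ᵀ (Y(υ) - Y(υ')) u₂ / (ω₂ ‖D (υ - υ')‖)) ≤ ν₂² t² / 2`, the
expectation being finite. When the denominator vanishes, the condition reads `Y(υ) = Y(υ')` almost
surely; for injective `D` this occurs only for `υ = υ'` and is void. -/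
def ExpMomentCondition {p : ℕ} {Ω : Type*} [MeasurableSpace Ω] (P : Measure Ω)
    (Y : EuclideanSpace ℝ (Fin p) → Ω → Matrix (Fin p) (Fin p) ℝ)
    (Υ : Set (EuclideanSpace ℝ (Fin p)))
    (D : EuclideanSpace ℝ (Fin p) →ₗ[ℝ] EuclideanSpace ℝ (Fin p))
    (υ₀ : EuclideanSpace ℝ (Fin p)) (rstar g ω₂ ν₂ : ℝ) : Prop :=
  ∀ r : ℝ, 0 < r → r < rstar →
    ∀ υ ∈ localSet Υ D υ₀ r, ∀ υ' ∈ localSet Υ D υ₀ r,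
      (D (υ - υ') ≠ 0 →
        ∀ t : ℝ, |t| ≤ g →
          ∀ u₁ u₂ : EuclideanSpace ℝ (Fin p), ‖u₁‖ ≤ 1 → ‖u₂‖ ≤ 1 →
            Integrable (fun ω => Real.exp (t * normIncr Y D ω₂ υ υ' u₁ u₂ ω)) P ∧
            cgf (normIncr Y D ω₂ υ υ' u₁ u₂) P t ≤ ν₂ ^ 2 * t ^ 2 / 2) ∧
      (D (υ - υ') = 0 → Y υ =ᵐ[P] Y υ')

end SpectralProcess

end

open Module Metric in
/-- Volume bound for the cardinality of an `ε`-separated family in a ball of radius `R`. -/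
theorem card_le_of_norm_le_of_separated {α E : Type*} [NormedAddCommGroup E] [NormedSpace ℝ E]
    [FiniteDimensional ℝ E] (f : α → E) (c : E) {R ε : ℝ} (hR : 0 ≤ R) (hε : 0 < ε)
    (N : Finset α) (hN : ∀ a ∈ N, ‖f a - c‖ ≤ R)
    (hsep : ∀ a ∈ N, ∀ b ∈ N, a ≠ b → ε ≤ ‖f a - f b‖) :
    (N.card : ℝ) ≤ (1 + 2 * R / ε) ^ finrank ℝ E := by
  borelize E
  let μ : Measure E := Measure.addHaar
  have hδ : 0 < ε / 2 := by positivity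
  have hρ : 0 < R + ε / 2 := by positivity
  have hdisj : Set.Pairwise (N : Set α) (Function.onFun Disjoint fun a => ball (f a) (ε / 2)) := by
    intro a ha b hb hab
    apply ball_disjoint_ball
    rw [dist_eq_norm]
    linarith [hsep a ha b hb hab]
  have hsub : (⋃ a ∈ N, ball (f a) (ε / 2)) ⊆ ball c (R + ε / 2) := by
    refine Set.iUnion₂_subset fun a ha => ball_subset_ball' ?_
    rw [dist_eq_norm]
    linarith [hN a ha]
  have hvol : (N.card : ENNReal) * ENNReal.ofReal ((ε / 2) ^ finrank ℝ E) * μ (ball 0 1) ≤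
      ENNReal.ofReal ((R + ε / 2) ^ finrank ℝ E) * μ (ball 0 1) :=
    calc
      _ = μ (⋃ a ∈ N, ball (f a) (ε / 2)) := by
        rw [measure_biUnion_finset hdisj fun c _ => measurableSet_ball]
        simp only [μ.addHaar_ball_of_pos _ hδ, Finset.sum_const, nsmul_eq_mul, mul_assoc]
      _ ≤ μ (ball c (R + ε / 2)) := measure_mono hsub
      _ = _ := by simp only [μ.addHaar_ball_of_pos _ hρ]
  have hcard := (ENNReal.mul_le_mul_iff_left (measure_ball_pos μ (0 : E) zero_lt_one).ne'
    measure_ball_lt_top.ne).1 hvol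
  have hcard' := ENNReal.toReal_le_of_le_ofReal (pow_nonneg hρ.le _) hcard
  rw [ENNReal.toReal_mul, ENNReal.toReal_natCast, ENNReal.toReal_ofReal (by positivity),
    ← le_div_iff₀ (by positivity), ← div_pow] at hcard'
  have hratio : (R + ε / 2) / (ε / 2) = 1 + 2 * R / ε := by
    field_simp
    ring
  rwa [hratio] at hcard'

open Module in
/-- A family in a ball of radius `R` has an internal `ε`-net of cardinality at most
`(1 + 2 R / ε) ^ dim`. -/
theorem exists_finset_net {α E : Type*} [NormedAddCommGroup E] [NormedSpace ℝ E]
    [FiniteDimensional ℝ E] (f : α → E) (c : E) {R ε : ℝ} (hR : 0 ≤ R) (hε : 0 < ε)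
    (S : Set α) (hS : ∀ a ∈ S, ‖f a - c‖ ≤ R) :
    ∃ N : Finset α, (∀ a ∈ N, a ∈ S) ∧ (N.card : ℝ) ≤ (1 + 2 * R / ε) ^ finrank ℝ E ∧
      ∀ a ∈ S, ∃ b ∈ N, ‖f a - f b‖ ≤ ε := by
  classical
  let T : Set ℕ := {n | ∃ N : Finset α, N.card = n ∧ (∀ a ∈ N, a ∈ S) ∧
    ∀ a ∈ N, ∀ b ∈ N, a ≠ b → ε ≤ ‖f a - f b‖}
  have hle : ∀ N : Finset α, (∀ a ∈ N, a ∈ S) →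
      (∀ a ∈ N, ∀ b ∈ N, a ≠ b → ε ≤ ‖f a - f b‖) →
      (N.card : ℝ) ≤ (1 + 2 * R / ε) ^ finrank ℝ E := fun N hN hsep =>
    card_le_of_norm_le_of_separated f c hR hε N (fun a ha => hS a (hN a ha)) hsep
  have hbdd : BddAbove T := by
    refine ⟨⌊(1 + 2 * R / ε) ^ finrank ℝ E⌋₊, ?_⟩
    rintro _ ⟨N, rfl, hN, hsep⟩
    exact Nat.le_floor (hle N hN hsep)
  have hne : T.Nonempty := ⟨0, ∅, by simp⟩
  obtain ⟨N, hcard, hN, hsep⟩ := Nat.sSup_mem hne hbdd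
  refine ⟨N, hN, hle N hN hsep, fun a ha => ?_⟩
  by_contra! hfar
  have haN : a ∉ N := fun h => by
    have := hfar a h
    simp at this
    linarith
  have hmem : N.card + 1 ∈ T := by
    refine ⟨insert a N, Finset.card_insert_of_notMem haN, ?_, ?_⟩
    · simpa [ha] using hN
    · intro b hb b' hb' hbb'
      rw [Finset.mem_insert] at hb hb'
      rcases hb with rfl | hb <;> rcases hb' with rfl | hb'
      · exact absurd rfl hbb'
      · exact (hfar b' hb').le
      · rw [norm_sub_rev]
        exact (hfar b hb).le
      · exact hsep b hb b' hb' hbb'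
  have := le_csSup hbdd hmem
  omega

/-- The spectral norm of a matrix is controlled by its bilinear form on a `1/2`-net of the unit
ball. -/
theorem matNorm_le_of_net {p : ℕ} (N : Finset (EuclideanSpace ℝ (Fin p)))
    (hN : ∀ u : EuclideanSpace ℝ (Fin p), ‖u‖ ≤ 1 → ∃ v ∈ N, ‖u - v‖ ≤ 1 / 2)
    (M : Matrix (Fin p) (Fin p) ℝ) {c : ℝ} (hc : 0 ≤ c)
    (h : ∀ u₁ ∈ N, ∀ u₂ ∈ N, SpectralProcess.bilin u₁ M u₂ ≤ c) :
    SpectralProcess.matNorm M ≤ 4 * c := by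
  unfold SpectralProcess.matNorm
  set A := Matrix.toEuclideanCLM (n := Fin p) (𝕜 := ℝ) M with hA
  have hvec : ∀ w : EuclideanSpace ℝ (Fin p), (∀ u ∈ N, inner ℝ u w ≤ c) → ‖w‖ ≤ 2 * c := by
    intro w hw
    rcases eq_or_ne w 0 with rfl | hw0
    · simpa using hc
    have hpos : 0 < ‖w‖ := norm_pos_iff.2 hw0
    obtain ⟨v, hv, hdist⟩ := hN (‖w‖⁻¹ • w) (by simp [norm_smul, hw0])
    have h1 : inner ℝ (‖w‖⁻¹ • w) w = ‖w‖ := by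
      rw [real_inner_smul_left, real_inner_self_eq_norm_sq]
      field_simp
    have h2 : inner ℝ (‖w‖⁻¹ • w) w = inner ℝ (‖w‖⁻¹ • w - v) w + inner ℝ v w := by
      rw [← inner_add_left, sub_add_cancel]
    have h3 := real_inner_le_norm (‖w‖⁻¹ • w - v) w
    have h4 := hw v hv
    nlinarith
  have hbound : ‖A‖ ≤ 2 * c + ‖A‖ / 2 := by
    refine ContinuousLinearMap.opNorm_le_of_unit_norm (by positivity) fun u hu => ?_
    obtain ⟨v, hv, hdist⟩ := hN u hu.le
    have h1 : ‖A v‖ ≤ 2 * c := by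
      refine hvec _ fun u₁ hu₁ => ?_
      rw [hA, Matrix.inner_toEuclideanCLM]
      exact h u₁ hu₁ v hv
    have h2 : A u = A v + A (u - v) := by rw [← map_add]; simp
    have h3 := A.le_opNorm (u - v)
    have h4 := norm_add_le (A v) (A (u - v))
    rw [h2]
    nlinarith [norm_nonneg A]
  linarith

theorem zfun_nonneg {g₀ x Q : ℝ} (hg : 0 ≤ g₀) (hxQ : 0 ≤ x + Q) :
    0 ≤ SpectralProcess.zfun g₀ x Q := by
  unfold SpectralProcess.zfun
  split_ifs <;> positivity

/-- Chernoff bound at a multiple of the quantile `𝔷(x, Q)`. -/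
theorem measure_zfun_le {Ω : Type*} [MeasurableSpace Ω] (P : Measure Ω) [IsProbabilityMeasure P]
    (X : Ω → ℝ) {g ν x Q : ℝ} (hg : 0 < g) (hν : 0 < ν) (hxQ : 0 ≤ x + Q)
    (hX : ∀ t : ℝ, |t| ≤ g → Integrable (fun ω => Real.exp (t * X ω)) P ∧
      cgf X P t ≤ ν ^ 2 * t ^ 2 / 2) {k : ℝ} (hk : 1 ≤ k) :
    P {ω | k * (ν * SpectralProcess.zfun (ν * g) x Q) ≤ X ω} ≤
      ENNReal.ofReal (Real.exp (-(k * (x + Q)))) := by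
  suffices h : ∃ t, 0 ≤ t ∧ |t| ≤ g ∧
      -t * (k * (ν * SpectralProcess.zfun (ν * g) x Q)) + ν ^ 2 * t ^ 2 / 2 ≤
        -(k * (x + Q)) by
    obtain ⟨t, ht0, htg, hle⟩ := h
    obtain ⟨hint, hcgf⟩ := hX t htg
    have hch := measure_ge_le_exp_cgf (k * (ν * SpectralProcess.zfun (ν * g) x Q)) ht0 hint
    rw [← ofReal_measureReal]
    exact ENNReal.ofReal_le_ofReal (hch.trans (Real.exp_le_exp.2 (by linarith)))
  unfold SpectralProcess.zfun
  split_ifs with hcase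
  · set s := √(2 * (x + Q))
    have hs0 : 0 ≤ s := Real.sqrt_nonneg _
    have hs : s ^ 2 = 2 * (x + Q) := Real.sq_sqrt (by linarith)
    refine ⟨s / ν, by positivity, ?_, ?_⟩
    · rw [abs_of_nonneg (by positivity), div_le_iff₀ hν]
      linarith
    · have : -(s / ν) * (k * (ν * s)) + ν ^ 2 * (s / ν) ^ 2 / 2 = -(k * s ^ 2) + s ^ 2 / 2 := by
        field_simp
      rw [this, hs]
      nlinarith
  · refine ⟨g, hg.le, (abs_of_pos hg).le, ?_⟩
    have : -g * (k * (ν * ((ν * g)⁻¹ * (x + Q) + ν * g / 2))) + ν ^ 2 * g ^ 2 / 2 =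
        -(k * (x + Q)) - (k - 1) * (ν ^ 2 * g ^ 2 / 2) := by
      field_simp
      ring
    rw [this]
    have : 0 ≤ (k - 1) * (ν ^ 2 * g ^ 2 / 2) := mul_nonneg (by linarith) (by positivity)
    linarith

theorem sum_succ_div_four_pow_le (n : ℕ) : ∑ k ∈ Finset.range n, ((k : ℝ) + 1) / 4 ^ k ≤ 2 := by
  have h : ∑ k ∈ Finset.range n, ((k : ℝ) + 1) / 4 ^ k =
      16 / 9 - (4 / 3 * n + 16 / 9) / 4 ^ n := by
    induction n with
    | zero => simp
    | succ n ih =>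
      rw [Finset.sum_range_succ, ih]
      push_cast
      field_simp
      ring
  rw [h]
  have : 0 ≤ (4 / 3 * (n : ℝ) + 16 / 9) / 4 ^ n := by positivity
  linarith

theorem exp_neg_six_le : Real.exp (-6) ≤ 1 / 400 := by
  have h : (400 : ℝ) ≤ Real.exp 6 := by
    have h1 : (2.7182818283 : ℝ) < Real.exp 1 := Real.exp_one_gt_d9
    have h2 : Real.exp 6 = Real.exp 1 ^ 6 := by rw [← Real.exp_nat_mul]; norm_num
    rw [h2]
    calc (400 : ℝ) ≤ 2.7182818283 ^ 6 := by norm_num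
      _ ≤ _ := by gcongr
  rw [Real.exp_neg, one_div]
  exact inv_anti₀ (by norm_num) h

/-- The union bound over the `k`-th level of the chain. -/
theorem level_union_bound {p : ℕ} (hp : p ≠ 0) {x : ℝ} (hx : 0 ≤ x) (k : ℕ) :
    (1 + 2 * 4 ^ (k + 1) : ℝ) ^ p * (25 ^ p * Real.exp (-((k + 1 : ℕ) * (x + 6 * p)))) ≤
      3 / 4 * (1 / 4) ^ k * Real.exp (-x) := by
  have hexp : Real.exp (-((k + 1 : ℕ) * (x + 6 * p))) ≤
      Real.exp (-x) * ((1 / 400 : ℝ) ^ (k + 1)) ^ p := by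
    have h1 : Real.exp (-((k + 1 : ℕ) * (x + 6 * p))) =
        Real.exp (-((k + 1 : ℕ) * x)) * (Real.exp (-6) ^ (k + 1)) ^ p := by
      rw [← Real.exp_nat_mul, ← Real.exp_nat_mul, ← Real.exp_add]
      congr 1
      ring
    rw [h1]
    have h2 : Real.exp (-((k + 1 : ℕ) * x)) ≤ Real.exp (-x) := by
      apply Real.exp_le_exp.2
      push_cast
      nlinarith [mul_nonneg (Nat.cast_nonneg (α := ℝ) k) hx]
    have h3 := exp_neg_six_le
    gcongr
  have hbase : (1 + 2 * 4 ^ (k + 1) : ℝ) * 25 * (1 / 400) ^ (k + 1) ≤ 3 / 4 * (1 / 4) ^ k := by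
    have h4 : (1 : ℝ) ≤ 4 ^ k := one_le_pow₀ (by norm_num)
    have h5 : (1 + 2 * 4 ^ (k + 1) : ℝ) ≤ 9 * 4 ^ k := by rw [pow_succ]; linarith
    calc (1 + 2 * 4 ^ (k + 1) : ℝ) * 25 * (1 / 400) ^ (k + 1)
        ≤ 9 * 4 ^ k * 25 * (1 / 400) ^ (k + 1) := by gcongr
      _ = 9 / 16 * (1 / 100) ^ k := by
        rw [pow_succ, show (1 / 100 : ℝ) = 4 * (1 / 400) by norm_num, mul_pow]
        ring
      _ ≤ 3 / 4 * (1 / 4) ^ k :=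
        mul_le_mul (by norm_num) (pow_le_pow_left₀ (by norm_num) (by norm_num) k)
          (by positivity) (by norm_num)
  have hone : 3 / 4 * (1 / 4 : ℝ) ^ k ≤ 1 := by
    have : (1 / 4 : ℝ) ^ k ≤ 1 := pow_le_one₀ (by norm_num) (by norm_num)
    linarith
  calc (1 + 2 * 4 ^ (k + 1) : ℝ) ^ p * (25 ^ p * Real.exp (-((k + 1 : ℕ) * (x + 6 * p))))
      ≤ (1 + 2 * 4 ^ (k + 1) : ℝ) ^ p *
          (25 ^ p * (Real.exp (-x) * ((1 / 400 : ℝ) ^ (k + 1)) ^ p)) := by gcongr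
    _ = ((1 + 2 * 4 ^ (k + 1) : ℝ) * 25 * (1 / 400) ^ (k + 1)) ^ p * Real.exp (-x) := by
      rw [mul_pow, mul_pow]
      ring
    _ ≤ (3 / 4 * (1 / 4) ^ k) ^ p * Real.exp (-x) := by gcongr
    _ ≤ 3 / 4 * (1 / 4) ^ k * Real.exp (-x) := by
      gcongr
      exact pow_le_of_le_one (by positivity) hone hp

theorem sum_three_quarters_mul_pow_le (n : ℕ) :
    ∑ k ∈ Finset.range n, (3 / 4 * (1 / 4) ^ k : ℝ) ≤ 1 := by
  rw [← Finset.mul_sum, geom_sum_eq (by norm_num)]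
  have : (0 : ℝ) ≤ (1 / 4) ^ n := by positivity
  rw [div_eq_mul_inv]
  norm_num
  linarith

open Filter in
theorem Finset.exists_nat_separating {α E : Type*} [NormedAddCommGroup E] (f : α → E)
    (F : Finset α) (r : ℝ) :
    ∃ K : ℕ, ∀ a ∈ F, ∀ b ∈ F, ‖f a - f b‖ ≤ r / 4 ^ K → f a = f b := by
  have hlim : Tendsto (fun k : ℕ => r / 4 ^ k) atTop (nhds 0) :=
    tendsto_const_nhds.div_atTop (tendsto_pow_atTop_atTop_of_one_lt (by norm_num))
  have : ∀ᶠ k : ℕ in atTop, ∀ a ∈ F, ∀ b ∈ F, ‖f a - f b‖ ≤ r / 4 ^ k → f a = f b := by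
    rw [Filter.eventually_all_finset]
    intro a _
    rw [Filter.eventually_all_finset]
    intro b _
    by_cases hab : f a = f b
    · exact Eventually.of_forall fun _ _ => hab
    · filter_upwards [hlim.eventually_lt_const (norm_pos_iff.2 (sub_ne_zero.2 hab))] with k hk hle
      linarith
  exact this.exists

open Module in
/-- Chaining bound for the maximum over a finite set of a process whose increments have
exponential tails with respect to a pseudo-distance pulled back from a finite-dimensional space. -/
theorem measure_exists_norm_gt_le_of_chaining {Ω α E V : Type*} [MeasurableSpace Ω]
    (P : Measure Ω) [NormedAddCommGroup E] [NormedSpace ℝ E] [FiniteDimensional ℝ E]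
    [NormedAddCommGroup V] (Z : α → Ω → V) (f : α → E) (F : Finset α) {a₀ : α} (ha₀ : a₀ ∈ F)
    {r C x : ℝ} (hr : 0 < r) (hC : 0 ≤ C) (hx : 0 ≤ x) {p : ℕ} (hp : p ≠ 0)
    (hdim : finrank ℝ E = p) (hF : ∀ a ∈ F, ‖f a - f a₀‖ ≤ r)
    (hZ₀ : Z a₀ =ᵐ[P] 0) (heq : ∀ a ∈ F, ∀ b ∈ F, f a = f b → Z a =ᵐ[P] Z b)
    (hinc : ∀ a ∈ F, ∀ b ∈ F, ∀ δ, ‖f a - f b‖ ≤ δ → ∀ k : ℕ, 1 ≤ k →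
      P {ω | k * C * δ < ‖Z a ω - Z b ω‖} ≤
        ENNReal.ofReal (25 ^ p * Real.exp (-(k * (x + 6 * p))))) :
    P {ω | ∃ a ∈ F, 2 * C * r < ‖Z a ω‖} ≤ ENNReal.ofReal (Real.exp (-x)) := by
  have hnet : ∀ k : ℕ, ∃ N : Finset α, (∀ a ∈ N, a ∈ F) ∧
      (N.card : ℝ) ≤ (1 + 2 * 4 ^ k) ^ p ∧ (k = 0 → N = {a₀}) ∧
      ∀ a ∈ F, ∃ b ∈ N, ‖f a - f b‖ ≤ r / 4 ^ k := by
    intro k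
    rcases Nat.eq_zero_or_pos k with rfl | hk
    · refine ⟨{a₀}, by simpa using ha₀, ?_, fun _ => rfl, by simpa using hF⟩
      simpa using one_le_pow₀ (by norm_num : (1 : ℝ) ≤ 1 + 2)
    · obtain ⟨N, hN, hcard, hcov⟩ :=
        exists_finset_net f (f a₀) hr.le (ε := r / 4 ^ k) (by positivity) (F : Set α) hF
      refine ⟨N, hN, ?_, fun h => absurd h hk.ne', hcov⟩
      rw [hdim] at hcard
      convert hcard using 2
      field_simp
  choose N hNF hNcard hN₀ hNcov using hnet
  choose! proj hprojN hproj using hNcov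
  obtain ⟨K, hK⟩ := F.exists_nat_separating f r
  let bad : ℕ → Set Ω := fun k =>
    {ω | ∃ v ∈ N (k + 1), (k + 1 : ℕ) * C * (r / 4 ^ k) < ‖Z v ω - Z (proj k v) ω‖}
  have hbad : ∀ k, P (bad k) ≤ ENNReal.ofReal (3 / 4 * (1 / 4) ^ k * Real.exp (-x)) := by
    intro k
    have hset : bad k = ⋃ v ∈ N (k + 1),
        {ω | (k + 1 : ℕ) * C * (r / 4 ^ k) < ‖Z v ω - Z (proj k v) ω‖} := by
      ext ω
      simp [bad]
    rw [hset]
    calc P _ ≤ ∑ v ∈ N (k + 1),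
          P {ω | (k + 1 : ℕ) * C * (r / 4 ^ k) < ‖Z v ω - Z (proj k v) ω‖} :=
            measure_biUnion_finset_le _ _
      _ ≤ ∑ v ∈ N (k + 1),
          ENNReal.ofReal (25 ^ p * Real.exp (-((k + 1 : ℕ) * (x + 6 * p)))) := by
        refine Finset.sum_le_sum fun v hv => ?_
        have hvF := hNF _ v hv
        exact hinc v hvF _ (hNF _ _ (hprojN k v hvF)) _ (hproj k v hvF) (k + 1) (by omega)
      _ = ENNReal.ofReal ((N (k + 1)).card *
          (25 ^ p * Real.exp (-((k + 1 : ℕ) * (x + 6 * p))))) := by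
        rw [Finset.sum_const, nsmul_eq_mul, ENNReal.ofReal_mul (Nat.cast_nonneg _),
          ENNReal.ofReal_natCast]
      _ ≤ _ := by
        refine ENNReal.ofReal_le_ofReal (le_trans ?_ (level_union_bound hp hx k))
        gcongr
        exact hNcard (k + 1)
  have hunion : P (⋃ k ∈ Finset.range K, bad k) ≤ ENNReal.ofReal (Real.exp (-x)) :=
    calc P _ ≤ ∑ k ∈ Finset.range K, P (bad k) := measure_biUnion_finset_le _ _
      _ ≤ ∑ k ∈ Finset.range K, ENNReal.ofReal (3 / 4 * (1 / 4) ^ k * Real.exp (-x)) :=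
        Finset.sum_le_sum fun k _ => hbad k
      _ = ENNReal.ofReal ((∑ k ∈ Finset.range K, (3 / 4 * (1 / 4) ^ k)) * Real.exp (-x)) := by
        rw [Finset.sum_mul, ENNReal.ofReal_sum_of_nonneg fun _ _ => by positivity]
      _ ≤ _ := by
        refine ENNReal.ofReal_le_ofReal ?_
        exact mul_le_of_le_one_left (Real.exp_pos _).le (sum_three_quarters_mul_pow_le K)
  have hlast : ∀ᵐ ω ∂P, ∀ a ∈ F, Z a ω = Z (proj K a) ω := by
    rw [Filter.eventually_all_finset]
    intro a ha
    have hpF := hNF _ _ (hprojN K a ha)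
    exact heq a ha _ hpF (hK a ha _ hpF (hproj K a ha))
  refine le_trans (measure_mono_ae ?_) hunion
  filter_upwards [hlast, hZ₀] with ω hω hω₀ hmem
  obtain ⟨a, ha, hgt⟩ := hmem
  by_contra hgood
  have hstep : ∀ k < K, ∀ v ∈ N (k + 1),
      ‖Z v ω - Z (proj k v) ω‖ ≤ C * r * (((k : ℝ) + 1) / 4 ^ k) := by
    intro k hk v hv
    by_contra! hlt
    have hthr : (k + 1 : ℕ) * C * (r / 4 ^ k) = C * r * (((k : ℝ) + 1) / 4 ^ k) := by
      push_cast
      ring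
    exact hgood (Set.mem_biUnion (Finset.mem_coe.2 (Finset.mem_range.2 hk))
      ⟨v, hv, hthr.trans_lt hlt⟩)
  have hchain : ∀ k ≤ K, ∀ v ∈ N k,
      ‖Z v ω‖ ≤ C * r * ∑ j ∈ Finset.range k, ((j : ℝ) + 1) / 4 ^ j := by
    intro k
    induction k with
    | zero =>
      intro _ v hv
      rw [hN₀ 0 rfl, Finset.mem_singleton] at hv
      simp [hv, hω₀]
    | succ k ih =>
      intro hk v hv
      have h1 := hstep k (by omega) v hv
      have h2 := ih (by omega) _ (hprojN k v (hNF _ v hv))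
      have h3 := norm_add_le (Z v ω - Z (proj k v) ω) (Z (proj k v) ω)
      rw [sub_add_cancel] at h3
      rw [Finset.sum_range_succ, mul_add]
      linarith
  have h1 := hchain K le_rfl _ (hprojN K a ha)
  rw [← hω a ha] at h1
  have h2 := mul_le_mul_of_nonneg_left (sum_succ_div_four_pow_le K) (mul_nonneg hC hr.le)
  linarith

theorem continuous_matNorm (p : ℕ) : Continuous (SpectralProcess.matNorm (p := p)) := by
  have h : Continuous fun M : Matrix (Fin p) (Fin p) ℝ =>
      Matrix.toEuclideanCLM (n := Fin p) (𝕜 := ℝ) M :=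
    LinearMap.continuous_of_finiteDimensional
      ({ toFun := Matrix.toEuclideanCLM (n := Fin p) (𝕜 := ℝ)
         map_add' := map_add _
         map_smul' := map_smul _ } : Matrix (Fin p) (Fin p) ℝ →ₗ[ℝ] _)
  exact h.norm

/-- Tail bound for the spectral norm of an increment of the process. -/
theorem measure_matNorm_increment_gt_le {p : ℕ} {Ω : Type*} [MeasurableSpace Ω] (P : Measure Ω)
    [IsProbabilityMeasure P] (Y : EuclideanSpace ℝ (Fin p) → Ω → Matrix (Fin p) (Fin p) ℝ)
    (D : EuclideanSpace ℝ (Fin p) →ₗ[ℝ] EuclideanSpace ℝ (Fin p)) {g ω₂ ν₂ x Q : ℝ}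
    (hg : 0 < g) (hω₂ : 0 < ω₂) (hν₂ : 0 < ν₂) (hxQ : 0 ≤ x + Q)
    (υ υ' : EuclideanSpace ℝ (Fin p))
    (hne : D (υ - υ') ≠ 0 → ∀ t : ℝ, |t| ≤ g →
      ∀ u₁ u₂ : EuclideanSpace ℝ (Fin p), ‖u₁‖ ≤ 1 → ‖u₂‖ ≤ 1 →
        Integrable (fun ω => Real.exp (t * SpectralProcess.normIncr Y D ω₂ υ υ' u₁ u₂ ω)) P ∧
        cgf (SpectralProcess.normIncr Y D ω₂ υ υ' u₁ u₂) P t ≤ ν₂ ^ 2 * t ^ 2 / 2)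
    (heq : D (υ - υ') = 0 → Y υ =ᵐ[P] Y υ')
    {δ : ℝ} (hδ : ‖D (υ - υ')‖ ≤ δ) {k : ℝ} (hk : 1 ≤ k) :
    P {ω | k * (4 * (ω₂ * (ν₂ * SpectralProcess.zfun (ν₂ * g) x Q))) * δ <
        SpectralProcess.matNorm (Y υ ω - Y υ' ω)} ≤
      ENNReal.ofReal (25 ^ p * Real.exp (-(k * (x + Q)))) := by
  have hz : 0 ≤ SpectralProcess.zfun (ν₂ * g) x Q := zfun_nonneg (by positivity) hxQ
  set z := SpectralProcess.zfun (ν₂ * g) x Q with hz_def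
  have hδ0 : 0 ≤ δ := (norm_nonneg _).trans hδ
  obtain ⟨N, hN1, hNcard, hNcov⟩ := exists_finset_net (fun u : EuclideanSpace ℝ (Fin p) => u) 0
    (R := 1) (ε := 1 / 2) (by norm_num) (by norm_num) {u | ‖u‖ ≤ 1} (by simp)
  have hNcard' : (N.card : ℝ) ≤ 5 ^ p := by
    refine hNcard.trans (le_of_eq ?_)
    rw [finrank_euclideanSpace_fin]
    norm_num
  have hentry : ∀ u₁ ∈ N, ∀ u₂ ∈ N,
      P {ω | k * (ω₂ * (ν₂ * z)) * δ < SpectralProcess.bilin u₁ (Y υ ω - Y υ' ω) u₂} ≤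
        ENNReal.ofReal (Real.exp (-(k * (x + Q)))) := by
    intro u₁ hu₁ u₂ hu₂
    by_cases hD : D (υ - υ') = 0
    · refine le_of_eq_of_le ?_ zero_le
      rw [← nonpos_iff_eq_zero, ← measure_empty (μ := P)]
      refine measure_mono_ae ?_
      filter_upwards [heq hD] with ω hω hmem
      have hnn : 0 ≤ k * (ω₂ * (ν₂ * z)) * δ := by positivity
      have hlt : k * (ω₂ * (ν₂ * z)) * δ < SpectralProcess.bilin u₁ (Y υ ω - Y υ' ω) u₂ := hmem
      rw [hω, sub_self] at hlt
      simp only [SpectralProcess.bilin, Matrix.zero_mulVec, dotProduct_zero] at hlt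
      exact absurd hlt (not_lt.2 hnn)
    · have hpos : 0 < ‖D (υ - υ')‖ := norm_pos_iff.2 hD
      refine le_trans (measure_mono fun ω hω => ?_) (measure_zfun_le P
        (SpectralProcess.normIncr Y D ω₂ υ υ' u₁ u₂) hg hν₂ hxQ
        (fun t ht => hne hD t ht u₁ u₂ (hN1 _ hu₁) (hN1 _ hu₂)) hk)
      have hlt : k * (ω₂ * (ν₂ * z)) * δ < SpectralProcess.bilin u₁ (Y υ ω - Y υ' ω) u₂ := hω
      change k * (ν₂ * z) ≤ SpectralProcess.bilin u₁ (Y υ ω - Y υ' ω) u₂ / (ω₂ * ‖D (υ - υ')‖)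
      rw [le_div_iff₀ (by positivity)]
      have : k * (ω₂ * (ν₂ * z)) * ‖D (υ - υ')‖ ≤ k * (ω₂ * (ν₂ * z)) * δ := by gcongr
      linarith
  have hsub : {ω | k * (4 * (ω₂ * (ν₂ * z))) * δ < SpectralProcess.matNorm (Y υ ω - Y υ' ω)} ⊆
      ⋃ u₁ ∈ N, ⋃ u₂ ∈ N,
        {ω | k * (ω₂ * (ν₂ * z)) * δ < SpectralProcess.bilin u₁ (Y υ ω - Y υ' ω) u₂} := by
    intro ω hω
    by_contra hnot
    simp only [Set.mem_iUnion, Set.mem_ofPred_eq, not_exists, not_lt] at hnot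
    have hle := matNorm_le_of_net N hNcov (Y υ ω - Y υ' ω)
      (c := k * (ω₂ * (ν₂ * z)) * δ) (by positivity) hnot
    have hlt : k * (4 * (ω₂ * (ν₂ * z))) * δ < SpectralProcess.matNorm (Y υ ω - Y υ' ω) := hω
    linarith
  calc P _ ≤ P (⋃ u₁ ∈ N, ⋃ u₂ ∈ N,
        {ω | k * (ω₂ * (ν₂ * z)) * δ < SpectralProcess.bilin u₁ (Y υ ω - Y υ' ω) u₂}) :=
          measure_mono hsub
    _ ≤ ∑ u₁ ∈ N, ∑ u₂ ∈ N, ENNReal.ofReal (Real.exp (-(k * (x + Q)))) := by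
      refine (measure_biUnion_finset_le _ _).trans (Finset.sum_le_sum fun u₁ hu₁ => ?_)
      exact (measure_biUnion_finset_le _ _).trans
        (Finset.sum_le_sum fun u₂ hu₂ => hentry u₁ hu₁ u₂ hu₂)
    _ = ENNReal.ofReal ((N.card * N.card : ℝ) * Real.exp (-(k * (x + Q)))) := by
      rw [Finset.sum_const, Finset.sum_const, nsmul_eq_mul, nsmul_eq_mul, ← mul_assoc,
        ENNReal.ofReal_mul (by positivity), ENNReal.ofReal_mul (by positivity),
        ENNReal.ofReal_natCast]
    _ ≤ _ := by
      refine ENNReal.ofReal_le_ofReal ?_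
      have : (25 : ℝ) ^ p = 5 ^ p * 5 ^ p := by rw [← mul_pow]; norm_num
      rw [this]
      gcongr

/-- Passage from finite subsets to a set in which they are dense, along continuous paths. -/
theorem exists_measurableSet_forall_le_of_finset {Ω α : Type*} [MeasurableSpace Ω]
    (P : Measure Ω) [IsProbabilityMeasure P] [TopologicalSpace α]
    [SecondCountableTopology α] (h : α → Ω → ℝ) {S S' T : Set α} (hST : S ⊆ T) (hS'T : S' ⊆ T)
    (hcl : S' ⊆ closure S) (hcont : ∀ᵐ ω ∂P, ContinuousOn (fun a => h a ω) T) {c x : ℝ}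
    (hfin : ∀ F : Finset α, (∀ a ∈ F, a ∈ S) →
      P {ω | ∃ a ∈ F, c < h a ω} ≤ ENNReal.ofReal (Real.exp (-x))) :
    ∃ A : Set Ω, MeasurableSet A ∧ 1 - Real.exp (-x) ≤ P.real A ∧
      ∀ ω ∈ A, ∀ a ∈ S', h a ω ≤ c := by
  classical
  obtain ⟨U, hUS, hUc, hUd⟩ : ∃ U : Set α, U ⊆ S ∧ U.Countable ∧ S ⊆ closure U := by
    obtain ⟨U, hUc, hUd⟩ := TopologicalSpace.exists_countable_dense S
    exact ⟨Subtype.val '' U, by simp, hUc.image _, Subtype.dense_iff.1 hUd⟩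
  have := hUc.to_subtype
  let bad : Finset U → Set Ω := fun F => {ω | ∃ a ∈ F, c < h a ω}
  have hmono : Monotone bad := by
    rintro F G hFG ω ⟨a, ha, hlt⟩
    exact ⟨a, hFG ha, hlt⟩
  have hB : P (⋃ F, bad F) ≤ ENNReal.ofReal (Real.exp (-x)) := by
    rw [hmono.measure_iUnion]
    refine iSup_le fun F => ?_
    refine le_trans (measure_mono ?_) (hfin (F.image Subtype.val) ?_)
    · rintro ω ⟨a, ha, hlt⟩
      exact ⟨a, Finset.mem_image_of_mem _ ha, hlt⟩
    · intro a ha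
      obtain ⟨b, _, rfl⟩ := Finset.mem_image.1 ha
      exact hUS b.2
  set B := (⋃ F, bad F) ∪ {ω | ¬ ContinuousOn (fun a => h a ω) T} with hB_def
  have hBle : P (toMeasurable P B) ≤ ENNReal.ofReal (Real.exp (-x)) := by
    rw [measure_toMeasurable]
    exact (measure_union_le _ _).trans (by rw [ae_iff.1 hcont, add_zero]; exact hB)
  refine ⟨(toMeasurable P B)ᶜ, (measurableSet_toMeasurable P B).compl, ?_, ?_⟩
  · rw [probReal_compl_eq_one_sub (measurableSet_toMeasurable P B)]
    have : P.real (toMeasurable P B) ≤ Real.exp (-x) :=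
      ENNReal.toReal_le_of_le_ofReal (Real.exp_pos _).le hBle
    linarith
  · intro ω hω a ha
    have hωB : ω ∉ B := fun hmem => hω (subset_toMeasurable P B hmem)
    simp only [hB_def, Set.mem_union, not_or, Set.mem_ofPred_eq, not_not] at hωB
    obtain ⟨hgood, hc⟩ := hωB
    have hU : ∀ b ∈ U, h b ω ≤ c := by
      intro b hb
      by_contra! hlt
      exact hgood (Set.mem_iUnion.2 ⟨{⟨b, hb⟩}, ⟨b, hb⟩, Finset.mem_singleton_self _, hlt⟩)
    have haU : a ∈ closure U := closure_minimal hUd isClosed_closure (hcl ha)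
    have hcw : ContinuousWithinAt (fun a => h a ω) U a :=
      (hc a (hS'T ha)).mono (hUS.trans hST)
    have := hcw.mem_closure_image haU
    exact closure_minimal (by rintro _ ⟨b, hb, rfl⟩; exact hU b hb) isClosed_Iic this

theorem mainTheorem7 {p : ℕ} {Ω : Type*} [MeasurableSpace Ω] (P : Measure Ω)
    [IsProbabilityMeasure P]
    (Y : EuclideanSpace ℝ (Fin p) → Ω → Matrix (Fin p) (Fin p) ℝ)
    (Υ : Set (EuclideanSpace ℝ (Fin p)))
    (D : EuclideanSpace ℝ (Fin p) →ₗ[ℝ] EuclideanSpace ℝ (Fin p))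
    (υ₀ : EuclideanSpace ℝ (Fin p)) (hυ₀ : υ₀ ∈ Υ)
    (rstar g ω₂ ν₂ : ℝ) (hrstar : 0 < rstar) (hg : 0 < g) (hω₂ : 0 < ω₂) (hν₂ : 0 < ν₂)
    (hmeas : ∀ υ ∈ Υ, ∀ i j, Measurable (fun ω => Y υ ω i j))
    (hcont : ∀ᵐ ω ∂P, ContinuousOn (fun υ => Y υ ω) (SpectralProcess.localSet Υ D υ₀ rstar))
    (hzero : Y υ₀ =ᵐ[P] 0)
    (hexp : SpectralProcess.ExpMomentCondition P Y Υ D υ₀ rstar g ω₂ ν₂)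
    (r : ℝ) (hr0 : 0 ≤ r) (hr : r ≤ rstar)
    (hend : r = rstar →
      SpectralProcess.localSet Υ D υ₀ rstar ⊆ closure {υ | υ ∈ Υ ∧ ‖D (υ - υ₀)‖ < rstar})
    (x : ℝ) (hx : 0 ≤ x) :
    ∃ A : Set Ω, MeasurableSet A ∧ 1 - Real.exp (-x) ≤ P.real A ∧
      ∀ ω ∈ A, ∀ υ ∈ SpectralProcess.localSet Υ D υ₀ r,
        SpectralProcess.matNorm (Y υ ω) ≤
          9 * ω₂ * ν₂ * SpectralProcess.zfun (ν₂ * g) x (6 * p) * r := by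
  classical
  have hxQ : 0 ≤ x + 6 * (p : ℝ) := by positivity
  have hz : 0 ≤ SpectralProcess.zfun (ν₂ * g) x (6 * p) := zfun_nonneg (by positivity) hxQ
  set z := SpectralProcess.zfun (ν₂ * g) x (6 * p) with hz_def
  let S : Set (EuclideanSpace ℝ (Fin p)) :=
    {υ | υ ∈ Υ ∧ ‖D (υ - υ₀)‖ ≤ r ∧ ‖D (υ - υ₀)‖ < rstar}
  have hυ₀S : υ₀ ∈ S := ⟨hυ₀, by simpa using hr0, by simpa using hrstar⟩
  have hclosure : SpectralProcess.localSet Υ D υ₀ r ⊆ closure S := by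
    rcases hr.lt_or_eq with hlt | rfl
    · exact fun υ hυ => subset_closure ⟨hυ.1, hυ.2, hυ.2.trans_lt hlt⟩
    · exact (hend rfl).trans (closure_mono fun υ hυ => ⟨hυ.1, hυ.2.le, hυ.2⟩)
  have hpair : ∀ υ ∈ S, ∀ υ' ∈ S, _ := fun υ hυ υ' hυ' =>
    hexp (max (max ‖D (υ - υ₀)‖ ‖D (υ' - υ₀)‖) (rstar / 2))
      (lt_max_of_lt_right (by linarith))
      (max_lt (max_lt hυ.2.2 hυ'.2.2) (by linarith))
      υ ⟨hυ.1, (le_max_left _ _).trans (le_max_left _ _)⟩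
      υ' ⟨hυ'.1, (le_max_right _ _).trans (le_max_left _ _)⟩
  refine exists_measurableSet_forall_le_of_finset P
    (fun υ ω => SpectralProcess.matNorm (Y υ ω)) (S := S)
    (T := SpectralProcess.localSet Υ D υ₀ rstar) (fun υ hυ => ⟨hυ.1, hυ.2.2.le⟩)
    (fun υ hυ => ⟨hυ.1, hυ.2.trans hr⟩) hclosure ?_ fun F hF => ?_
  · filter_upwards [hcont] with ω hω
    exact (continuous_matNorm p).comp_continuousOn hω
  rcases Nat.eq_zero_or_pos p with rfl | hp
  · refine le_of_eq_of_le ?_ zero_le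
    convert measure_empty (μ := P)
    ext ω
    simp only [Set.mem_ofPred_eq, Set.mem_empty_iff_false, iff_false, not_exists, not_and, not_lt]
    intro υ _
    have hY : Y υ ω = 0 := Subsingleton.elim _ _
    rw [hY, SpectralProcess.matNorm, map_zero, norm_zero]
    positivity
  rcases hr0.eq_or_lt with rfl | hrpos
  · refine le_of_eq_of_le ?_ zero_le
    have hF0 : ∀ᵐ ω ∂P, ∀ υ ∈ F, Y υ ω = 0 := by
      rw [Filter.eventually_all_finset]
      intro υ hυ
      have hD : D (υ - υ₀) = 0 := norm_le_zero_iff.1 (hF υ hυ).2.1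
      exact ((hpair υ (hF υ hυ) υ₀ hυ₀S).2 hD).trans hzero
    rw [← nonpos_iff_eq_zero, ← measure_empty (μ := P)]
    refine measure_mono_ae ?_
    filter_upwards [hF0] with ω hω hmem
    obtain ⟨υ, hυ, hlt⟩ := hmem
    rw [hω υ hυ, SpectralProcess.matNorm, map_zero, norm_zero, mul_zero] at hlt
    exact absurd hlt (lt_irrefl _)
  have hG : ∀ υ ∈ insert υ₀ F, υ ∈ S := by
    intro υ hυ
    rcases Finset.mem_insert.1 hυ with rfl | hυ
    exacts [hυ₀S, hF υ hυ]
  have hmain := measure_exists_norm_gt_le_of_chaining P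
    (fun υ ω => Matrix.toEuclideanCLM (n := Fin p) (𝕜 := ℝ) (Y υ ω)) (fun υ => D υ)
    (insert υ₀ F) (Finset.mem_insert_self υ₀ F) (C := 4 * (ω₂ * (ν₂ * z))) hrpos
    (by positivity) hx hp.ne' finrank_euclideanSpace_fin
    (fun υ hυ => by rw [← map_sub]; exact (hG υ hυ).2.1)
    (by
      filter_upwards [hzero] with ω hω
      simp [hω])
    (fun υ hυ υ' hυ' hD => by
      filter_upwards [(hpair υ (hG υ hυ) υ' (hG υ' hυ')).2 (by rw [map_sub, hD, sub_self])]
        with ω hω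
      rw [hω])
    (fun υ hυ υ' hυ' δ hδ k hk => by
      have hcond := hpair υ (hG υ hυ) υ' (hG υ' hυ')
      have := measure_matNorm_increment_gt_le P Y D hg hω₂ hν₂ hxQ υ υ' hcond.1 hcond.2
        (δ := δ) (by rwa [map_sub]) (k := k) (by exact_mod_cast hk)
      simpa only [SpectralProcess.matNorm, map_sub] using this)
  refine le_trans (measure_mono ?_) hmain
  rintro ω ⟨υ, hυ, hlt⟩
  refine ⟨υ, Finset.mem_insert_of_mem hυ, lt_of_le_of_lt ?_ hlt⟩
  have : 0 ≤ ω₂ * ν₂ * z * r := by positivity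
  linarith
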